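/- Let $d$ be a dimension, $\alpha\in(0,2]$. Let $W$ be a standard exponential random variable, $\Theta$ a random variable uniform on $[-\pi/2,\pi/2]$ and $\boldsymbol N$ a $d$-dimensional standard Gaussian vector, all three independent; for instance $W=-\log U_1$ and $\Theta=\pi(U_2-\tfrac12)$, where $U_1,U_2$ are independent and uniform on $[0,1]$ and independent of $\boldsymbol N$ (for $U$ uniform on $[0,1]$, $-\log U$ is standard exponential and $\pi(U-\tfrac12)$ is uniform on $[-\pi/2,\pi/2]$). Put $$A_\alpha=\frac{\sin\left(\frac{\alpha\pi}{4}+\frac{\alpha}{2}\Theta\right)}{(\cos\Theta)^{2/\alpha}}\left(\frac{\cos\left(\frac{\alpha\pi}{4}+\left(\frac{\alpha}{2}-1\right)\Theta\right)}{W}\right)^{\frac{2}{\alpha}-1}$$ (with $0^0=1$ when $\alpha=2$). Let a symmetric $\alpha$-stable vector be a $d$-dimensional random vector $\boldsymbol S_\alpha$ with characteristic function $\mathbb E[e^{i\boldsymbol S_\alpha^\top\mathbf u}]=e^{-\|\mathbf u\|^\alpha}$, $\mathbf u\in\mathbb R^d$, where $\|\cdot\|$ is the Euclidean norm. Then $\sqrt{2A_\alpha}\,\boldsymbol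 N$ is symmetric $\alpha$-stable, and every symmetric $\alpha$-stable vector satisfies $$\boldsymbol S_\alpha\overset{d}{=}\sqrt{2A_\alpha}\,\boldsymbol N .$$ Moreover $A_\alpha>0$ almost surely. For $\alpha<2$, $A_\alpha$ is totally skewed (skewness $\beta=1$) $\frac{\alpha}{2}$-stable with scale $\sigma=(\cos\frac{\pi\alpha}{4})^{2/\alpha}$ and location $0$, that is, $$\mathbb E[e^{itA_\alpha}]=\exp\left(-\sigma^{\alpha/2}|t|^{\alpha/2}\left(1-i\,\mathrm{sign}(t)\tan\tfrac{\pi\alpha}{4}\right)\right),\quad t\in\mathbb R .$$ For $\alpha=2$ (the degenerate case), $A_2=1$ almost surely. -/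

import Mathlib

open MeasureTheory ProbabilityTheory

/-- `S` is a `d`-dimensional symmetric `α`-stable random vector: its characteristic function
`u ↦ 𝔼[exp (i ⟨S, u⟩)]` is `exp (-‖u‖ ^ α)`, with the Euclidean norm. -/
def IsSymmetricStable {Ω : Type*} [MeasurableSpace Ω] {d : ℕ} (α : ℝ)
    (S : Ω → EuclideanSpace ℝ (Fin d)) (P : Measure Ω) : Prop :=
  AEMeasurable S P ∧
    ∀ u : EuclideanSpace ℝ (Fin d), charFun (P.map S) u = ((Real.exp (-‖u‖ ^ α) : ℝ) : ℂ)

/-- The exponent of the characteristic function of the one-dimensional stable law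
`S_a(σ, β, m)` (index `a`, scale `σ`, skewness `β`, location `m`), in the standard
parametrization. -/
noncomputable def stableExponent (a σ β m t : ℝ) : ℂ :=
  if a = 1 then
    -((σ * |t| : ℝ) : ℂ) *
        (1 + Complex.I * ((β * (2 / Real.pi) * Real.sign t * Real.log |t| : ℝ) : ℂ))
      + Complex.I * ((m * t : ℝ) : ℂ)
  else
    -((σ ^ a * |t| ^ a : ℝ) : ℂ) *
        (1 - Complex.I * ((β * Real.sign t * Real.tan (Real.pi * a / 2) : ℝ) : ℂ))
      + Complex.I * ((m * t : ℝ) : ℂ)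

/-- The real random variable `X` has the nondegenerate stable law `S_a(σ, β, m)`. -/
def HasStableLaw {Ω : Type*} [MeasurableSpace Ω] (a σ β m : ℝ) (X : Ω → ℝ)
    (P : Measure Ω) : Prop :=
  0 < a ∧ a ≤ 2 ∧ 0 < σ ∧ β ∈ Set.Icc (-1 : ℝ) 1 ∧ AEMeasurable X P ∧
    ∀ t : ℝ, charFun (P.map X) t = Complex.exp (stableExponent a σ β m t)

/-- The value of the scaling variable `A_α` at `W = w`, `Θ = θ`. -/
noncomputable def stableScale (α w θ : ℝ) : ℝ :=
  Real.sin (α * Real.pi / 4 + α / 2 * θ) / Real.cos θ ^ (2 / α) *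
    (Real.cos (α * Real.pi / 4 + (α / 2 - 1) * θ) / w) ^ (2 / α - 1)

/-!
# Gaussian scale-mixture representation of symmetric stable vectors

Write `a = α / 2`, `φ = Θ + π / 2` and `A = A_α`. Everything follows from the Laplace transform
`𝔼[exp (-s A)] = exp (-s ^ a)` for `s ≥ 0` (`lintegral_exp_neg_mul_map_stableScale`). Conditioning
on `A`, the mixture `√(2A) N` has characteristic function `𝔼[exp (-A ‖u‖²)] = exp (-‖u‖ ^ α)`, and
characteristic functions determine laws. The characteristic function of `A` itself comes from
analytic continuation of the Laplace transform to a half-plane and passage to its boundary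
(`charFun_eq_of_laplace`).

For `a = 1` the variable `A` is constant. For `a < 1` let `E` be standard exponential and
independent of `A`. As `P (E > s A) = 𝔼[exp (-s A)]`, the Laplace transform formula says exactly
that `Y = (E / A) ^ a` is standard exponential, and the exponential law is determined by its
moments `n!` (`ext_of_moments_eq_factorial`). Since `𝔼[E ^ (a n)] = Γ(1 + a n)`, it remains to show
`𝔼[A ^ (-a n)] = n! / Γ(1 + a n)` for natural `n`.

Now `A ^ (-a n) = W ^ ((1 - a) n) * G(φ)` with
`G(φ) = sin φ ^ n / (sin (a φ) ^ (a n) * sin ((1 - a) φ) ^ ((1 - a) n))`. The factor in `W` has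
mean `Γ(1 + (1 - a) n)`, so the claim is that the mean of `G` over `(0, π)` is the binomial
coefficient of `n` over `a n`, a real number (`lintegral_stablePathIntegrand`). Along the path
`z = r e^{iφ}`, `r = sin (a φ) / sin ((1 - a) φ)`, the quantity `(1 + z) ^ n z ^ (-a n)` is real and
equal to `G(φ)`, whereas `(1 + z) ^ n z ^ (-a n - 1)` has an elementary primitive by the binomial
theorem. The path runs from the positive real axis to `-1`, so the fundamental theorem of calculus
gives `∫ G = π ∑ j, C(n, j) sinc (π (j - a n))`. This sum is identified with the binomial
coefficient for every real lower argument by Pascal's rule, the case `n = 0` being Euler's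
reflection formula (`sum_choose_mul_sinc`).
-/

/-! ### Binomial coefficients with real lower argument -/

theorem mul_sinc_self (x : ℝ) : x * Real.sinc x = Real.sin x := by
  by_cases hx : x = 0
  · simp [hx]
  · rw [Real.sinc_of_ne_zero hx]; field_simp

/-- The recursion of the entire function `1 / Γ`. It holds at the poles of `Γ` too, as `Γ` takes the
value `0` there. -/
theorem inv_Gamma_eq_mul_inv_Gamma_add_one (s : ℝ) :
    (Real.Gamma s)⁻¹ = s * (Real.Gamma (s + 1))⁻¹ := by
  by_cases hs : s = 0
  · simp [hs]
  · rw [Real.Gamma_add_one hs, mul_inv, mul_inv_cancel_left₀ hs]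

/-- Euler's reflection formula, in a form valid for all real `k`, integers included. -/
theorem sinc_pi_mul (k : ℝ) :
    Real.sinc (Real.pi * k) = (Real.Gamma (1 + k))⁻¹ * (Real.Gamma (1 - k))⁻¹ := by
  by_cases hk : k = 0
  · simp [hk]
  · rw [add_comm, Real.Gamma_add_one hk, ← mul_inv, mul_assoc, Real.Gamma_mul_Gamma_one_sub,
      Real.sinc_of_ne_zero (mul_ne_zero Real.pi_ne_zero hk)]
    field_simp

/-- The binomial coefficient of `n` over the real number `k`, as the value at `k` of the cardinal
series of the integer binomial coefficients. Both sides satisfy Pascal's rule in `(n, k)`. -/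
theorem sum_choose_mul_sinc (n : ℕ) (k : ℝ) :
    ∑ j ∈ Finset.range (n + 1), (n.choose j : ℝ) * Real.sinc (Real.pi * (j - k)) =
      n.factorial * ((Real.Gamma (1 + k))⁻¹ * (Real.Gamma (1 + n - k))⁻¹) := by
  induction n generalizing k with
  | zero =>
    simp [sinc_pi_mul, sub_eq_add_neg, mul_comm]
  | succ n ih =>
    rw [Finset.sum_choose_succ_mul (fun i _ => Real.sinc (Real.pi * ((i : ℝ) - k))) n, ih k]
    have h := ih (k - 1)
    have e : ∀ j : ℕ, ((j + 1 : ℕ) : ℝ) - k = (j : ℝ) - (k - 1) := fun j => by push_cast; ring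
    simp only [e]
    rw [h, show (1 : ℝ) + (k - 1) = k by ring, inv_Gamma_eq_mul_inv_Gamma_add_one k,
      inv_Gamma_eq_mul_inv_Gamma_add_one (1 + (n : ℝ) - k),
      show (1 : ℝ) + n - (k - 1) = 1 + n - k + 1 by ring,
      show (1 : ℝ) + ((n + 1 : ℕ) : ℝ) - k = 1 + n - k + 1 by push_cast; ring,
      Nat.factorial_succ, add_comm k 1]
    push_cast
    ring

/-! ### The path on which the integrand is real -/

/-- The modulus `r(φ) = sin (a φ) / sin ((1 - a) φ)` of the path `z = r(φ) e^{iφ}`, on which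
`(1 + z) ^ n * z ^ (-a n)` is real. Writing it with `sinc` gives the continuous value at `φ = 0`. -/
noncomputable def stablePathRadius (a φ : ℝ) : ℝ :=
  a * Real.sinc (a * φ) / ((1 - a) * Real.sinc ((1 - a) * φ))

theorem sinc_pos {x : ℝ} (h0 : 0 ≤ x) (h1 : x < Real.pi) : 0 < Real.sinc x := by
  rcases h0.eq_or_lt with rfl | h0
  · simp
  · rw [Real.sinc_of_ne_zero h0.ne']
    exact div_pos (Real.sin_pos_of_pos_of_lt_pi h0 h1) h0

theorem sinc_mul_pos {a φ : ℝ} (ha0 : 0 < a) (ha1 : a < 1) (h0 : 0 ≤ φ) (h1 : φ ≤ Real.pi) :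
    0 < Real.sinc (a * φ) :=
  sinc_pos (by positivity) (by nlinarith [Real.pi_pos])

theorem sin_mul_pos {a φ : ℝ} (ha0 : 0 < a) (ha1 : a ≤ 1) (h0 : 0 < φ) (h1 : φ < Real.pi) :
    0 < Real.sin (a * φ) :=
  Real.sin_pos_of_pos_of_lt_pi (by positivity) (by nlinarith)

theorem stablePathRadius_pos {a φ : ℝ} (ha0 : 0 < a) (ha1 : a < 1) (h0 : 0 ≤ φ)
    (h1 : φ ≤ Real.pi) : 0 < stablePathRadius a φ :=
  div_pos (mul_pos ha0 (sinc_mul_pos ha0 ha1 h0 h1))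
    (mul_pos (by linarith) (sinc_mul_pos (by linarith) (by linarith) h0 h1))

theorem stablePathRadius_eq {a φ : ℝ} (hφ : φ ≠ 0) :
    stablePathRadius a φ = Real.sin (a * φ) / Real.sin ((1 - a) * φ) := by
  rw [stablePathRadius, ← mul_sinc_self (a * φ), ← mul_sinc_self ((1 - a) * φ),
    mul_right_comm, mul_right_comm (1 - a), mul_div_mul_right _ _ hφ]

theorem stablePathRadius_pi {a : ℝ} (ha0 : 0 < a) (ha1 : a < 1) :
    stablePathRadius a Real.pi = 1 := by
  rw [stablePathRadius_eq Real.pi_ne_zero, show (1 - a) * Real.pi = Real.pi - a * Real.pi by ring,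
    Real.sin_pi_sub, div_self]
  exact (Real.sin_pos_of_pos_of_lt_pi (by positivity) (by nlinarith [Real.pi_pos])).ne'

theorem continuousOn_stablePathRadius {a : ℝ} (ha0 : 0 < a) (ha1 : a < 1) :
    ContinuousOn (stablePathRadius a) (Set.Icc 0 Real.pi) := by
  unfold stablePathRadius
  refine ContinuousOn.div ?_ ?_ fun x hx => ?_
  · exact (continuous_const.mul (Real.continuous_sinc.comp (by fun_prop))).continuousOn
  · exact (continuous_const.mul (Real.continuous_sinc.comp (by fun_prop))).continuousOn
  · exact (mul_pos (by linarith) (sinc_mul_pos (by linarith) (by linarith) hx.1 hx.2)).ne'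

theorem differentiableAt_stablePathRadius {a φ : ℝ} (ha0 : 0 < a) (ha1 : a < 1) (h0 : 0 < φ)
    (h1 : φ < Real.pi) : DifferentiableAt ℝ (stablePathRadius a) φ := by
  have h : DifferentiableAt ℝ (fun x => Real.sin (a * x) / Real.sin ((1 - a) * x)) φ :=
    DifferentiableAt.div (by fun_prop) (by fun_prop)
      (sin_mul_pos (by linarith) (by linarith) h0 h1).ne'
  refine h.congr_of_eventuallyEq ?_
  filter_upwards [eventually_ne_nhds h0.ne'] with x hx using stablePathRadius_eq hx

theorem hasDerivAt_mul_sinc (m φ : ℝ) :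
    HasDerivAt (fun x => x * Real.sinc (m * x)) (Real.cos (m * φ)) φ := by
  by_cases hm : m = 0
  · subst hm; simpa using hasDerivAt_id' φ
  · have e : (fun x => x * Real.sinc (m * x)) = fun x => Real.sin (m * x) / m := by
      ext x
      rw [← mul_sinc_self (m * x)]; field_simp
    rw [e]
    have := ((hasDerivAt_id φ).const_mul m).sin.div_const m
    simpa [hm] using this

/-- The real value of `(1 + z) ^ n * z ^ (-a n)` at the point `z = r(φ) e^{iφ}` of the path. -/
noncomputable def stablePathIntegrand (a : ℝ) (n : ℕ) (φ : ℝ) : ℝ :=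
  stablePathRadius a φ ^ (-(a * n)) * (Real.sin φ / Real.sin ((1 - a) * φ)) ^ n

/-- On the path, the argument of `1 + z` is `a` times the argument of `z`. -/
theorem one_add_stablePath {a φ : ℝ} (ha0 : 0 < a) (ha1 : a < 1) (h0 : 0 < φ)
    (h1 : φ < Real.pi) :
    1 + (stablePathRadius a φ : ℂ) * Complex.exp (φ * Complex.I) =
      ((Real.sin φ / Real.sin ((1 - a) * φ) : ℝ) : ℂ) * Complex.exp ((a * φ : ℝ) * Complex.I) := by
  have hs := (sin_mul_pos (a := 1 - a) (by linarith) (by linarith) h0 h1).ne'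
  have key : Real.sin ((1 - a) * φ) =
      Real.sin φ * Real.cos (a * φ) - Real.cos φ * Real.sin (a * φ) := by
    rw [← Real.sin_sub]; ring_nf
  rw [stablePathRadius_eq h0.ne']
  generalize Real.sin ((1 - a) * φ) = s at key hs ⊢
  apply Complex.ext
  · simp only [Complex.add_re, Complex.one_re, Complex.re_ofReal_mul,
      Complex.exp_ofReal_mul_I_re]
    field_simp
    rw [key]; ring
  · simp only [Complex.add_im, Complex.one_im, Complex.im_ofReal_mul,
      Complex.exp_ofReal_mul_I_im]
    field_simp
    ring

/-- The binomial expansion of `(1 + z) ^ n * z ^ (-a n)` on the path. The phases of the two factors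
cancel, so that the value is real. -/
theorem sum_choose_mul_stablePath {a φ : ℝ} (ha0 : 0 < a) (ha1 : a < 1) (n : ℕ) (h0 : 0 < φ)
    (h1 : φ < Real.pi) :
    ∑ j ∈ Finset.range (n + 1), (n.choose j : ℂ) *
      (((stablePathRadius a φ ^ ((j : ℝ) - a * n) : ℝ) : ℂ) *
        Complex.exp ((((j : ℝ) - a * n) * φ : ℝ) * Complex.I)) = stablePathIntegrand a n φ := by
  have hr := stablePathRadius_pos ha0 ha1 h0.le h1.le
  have hb := add_pow ((stablePathRadius a φ : ℂ) * Complex.exp (φ * Complex.I)) 1 n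
  rw [add_comm _ (1 : ℂ), one_add_stablePath ha0 ha1 h0 h1] at hb
  have : ∀ j : ℕ, (n.choose j : ℂ) *
      (((stablePathRadius a φ ^ ((j : ℝ) - a * n) : ℝ) : ℂ) *
        Complex.exp ((((j : ℝ) - a * n) * φ : ℝ) * Complex.I)) =
      ((stablePathRadius a φ ^ (-(a * n)) : ℝ) : ℂ) *
        Complex.exp (((-(a * n)) * φ : ℝ) * Complex.I) *
      (((stablePathRadius a φ : ℂ) * Complex.exp (φ * Complex.I)) ^ j * 1 ^ (n - j) *
        (n.choose j : ℂ)) := by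
    intro j
    rw [sub_eq_neg_add, Real.rpow_add hr, Real.rpow_natCast, mul_pow, ← Complex.exp_nat_mul, one_pow]
    have : Complex.exp (((-(a * n) + (j : ℝ)) * φ : ℝ) * Complex.I) =
        Complex.exp (((-(a * n)) * φ : ℝ) * Complex.I) * Complex.exp (j * (φ * Complex.I)) := by
      rw [← Complex.exp_add]; congr 1; push_cast; ring
    rw [this]; push_cast; ring
  simp only [this]
  rw [← Finset.mul_sum, ← hb, mul_pow, ← Complex.exp_nat_mul, stablePathIntegrand]
  have : Complex.exp (((-(a * n)) * φ : ℝ) * Complex.I) *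
      Complex.exp (n * ((a * φ : ℝ) * Complex.I)) = 1 := by
    rw [← Complex.exp_add, ← Complex.exp_zero]; congr 1; push_cast; ring
  push_cast at this ⊢
  linear_combination (((stablePathRadius a φ ^ (-(a * n)) : ℝ) : ℂ) *
    (Complex.sin φ / Complex.sin ((1 - a) * φ)) ^ n) * this

theorem stablePathIntegrand_nonneg {a φ : ℝ} (ha0 : 0 < a) (ha1 : a < 1) (n : ℕ) (h0 : 0 < φ)
    (h1 : φ < Real.pi) : 0 ≤ stablePathIntegrand a n φ := by
  have hr := stablePathRadius_pos ha0 ha1 h0.le h1.le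
  have hs := (sin_mul_pos (a := 1 - a) (by linarith) (by linarith) h0 h1)
  have := Real.sin_pos_of_pos_of_lt_pi h0 h1
  unfold stablePathIntegrand
  positivity

/-- The imaginary part of the primitive `∑ j, C(n, j) z ^ (j - a n) / (j - a n)` of
`(1 + z) ^ n * z ^ (-a n - 1)` along the path. In terms of `sinc` it is also correct for
`j = a n`, where the summand of the primitive is a logarithm. -/
noncomputable def stablePathPrimitive (a : ℝ) (n : ℕ) (φ : ℝ) : ℝ :=
  ∑ j ∈ Finset.range (n + 1), (n.choose j : ℝ) *
    (stablePathRadius a φ ^ ((j : ℝ) - a * n) * (φ * Real.sinc (((j : ℝ) - a * n) * φ)))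

/-- Along the path `dz / z = (r' / r + i) dφ`, and `(1 + z) ^ n * z ^ (-a n)` is real, so the
imaginary part of the primitive has derivative `(1 + z) ^ n * z ^ (-a n)`. -/
theorem hasDerivAt_stablePathPrimitive {a φ : ℝ} (ha0 : 0 < a) (ha1 : a < 1) (n : ℕ) (h0 : 0 < φ)
    (h1 : φ < Real.pi) :
    HasDerivAt (stablePathPrimitive a n) (stablePathIntegrand a n φ) φ := by
  have hr := stablePathRadius_pos ha0 ha1 h0.le h1.le
  set r := stablePathRadius a φ with hrdef
  set r' := deriv (stablePathRadius a) φ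
  have hd : HasDerivAt (stablePathRadius a) r' φ :=
    (differentiableAt_stablePathRadius ha0 ha1 h0 h1).hasDerivAt
  have hsum := sum_choose_mul_stablePath ha0 ha1 n h0 h1
  rw [← hrdef] at hsum
  have hre := congrArg Complex.re hsum
  have him := congrArg Complex.im hsum
  simp only [Complex.re_sum, Complex.im_sum, ← Complex.ofReal_natCast, Complex.re_ofReal_mul,
    Complex.im_ofReal_mul, Complex.exp_ofReal_mul_I_re, Complex.exp_ofReal_mul_I_im,
    Complex.ofReal_re, Complex.ofReal_im] at hre him
  have : HasDerivAt (stablePathPrimitive a n)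
      (∑ j ∈ Finset.range (n + 1), (n.choose j : ℝ) *
        ((r' * ((j : ℝ) - a * n) * r ^ ((j : ℝ) - a * n - 1)) *
            (φ * Real.sinc (((j : ℝ) - a * n) * φ)) +
          r ^ ((j : ℝ) - a * n) * Real.cos (((j : ℝ) - a * n) * φ))) φ := by
    unfold stablePathPrimitive
    refine HasDerivAt.fun_sum fun j _ => ?_
    exact ((hd.rpow_const (Or.inl hr.ne')).mul (hasDerivAt_mul_sinc _ φ)).const_mul _
  convert this using 1
  have e : ∀ j : ℕ, (n.choose j : ℝ) *
        ((r' * ((j : ℝ) - a * n) * r ^ ((j : ℝ) - a * n - 1)) *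
            (φ * Real.sinc (((j : ℝ) - a * n) * φ)) +
          r ^ ((j : ℝ) - a * n) * Real.cos (((j : ℝ) - a * n) * φ)) =
      (r' / r) * ((n.choose j : ℝ) * (r ^ ((j : ℝ) - a * n) * Real.sin (((j : ℝ) - a * n) * φ))) +
      (n.choose j : ℝ) * (r ^ ((j : ℝ) - a * n) * Real.cos (((j : ℝ) - a * n) * φ)) := by
    intro j
    rw [Real.rpow_sub_one hr.ne', ← mul_sinc_self (((j : ℝ) - a * n) * φ)]
    ring
  simp only [e]
  rw [Finset.sum_add_distrib, ← Finset.mul_sum, hre, him, mul_zero, zero_add]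

theorem continuousOn_stablePathPrimitive {a : ℝ} (ha0 : 0 < a) (ha1 : a < 1) (n : ℕ) :
    ContinuousOn (stablePathPrimitive a n) (Set.Icc 0 Real.pi) := by
  unfold stablePathPrimitive
  refine continuousOn_finsetSum _ fun j _ => continuousOn_const.mul (ContinuousOn.mul ?_ ?_)
  · exact (continuousOn_stablePathRadius ha0 ha1).rpow_const fun x hx =>
      Or.inl (stablePathRadius_pos ha0 ha1 hx.1 hx.2).ne'
  · exact (continuous_id.mul (Real.continuous_sinc.comp (by fun_prop))).continuousOn

/-- The mean of the integrand over `(0, π)` is the binomial coefficient of `n` over `a n`. -/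
theorem lintegral_stablePathIntegrand {a : ℝ} (ha0 : 0 < a) (ha1 : a < 1) (n : ℕ) :
    ∫⁻ φ in Set.Ioo 0 Real.pi, ENNReal.ofReal (stablePathIntegrand a n φ) =
      ENNReal.ofReal (Real.pi * (n.factorial *
        ((Real.Gamma (1 + a * n))⁻¹ * (Real.Gamma (1 + (1 - a) * n))⁻¹))) := by
  have hder : ∀ x ∈ Set.Ioo 0 Real.pi,
      HasDerivAt (stablePathPrimitive a n) (stablePathIntegrand a n x) x :=
    fun x hx => hasDerivAt_stablePathPrimitive ha0 ha1 n hx.1 hx.2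
  have hcont := continuousOn_stablePathPrimitive ha0 ha1 n
  have hpos : ∀ x ∈ Set.Ioo 0 Real.pi, 0 ≤ stablePathIntegrand a n x :=
    fun x hx => stablePathIntegrand_nonneg ha0 ha1 n hx.1 hx.2
  have hint := intervalIntegral.integrableOn_deriv_of_nonneg hcont hder hpos
  have hval := intervalIntegral.integral_eq_sub_of_hasDerivAt_of_le Real.pi_pos.le hcont hder
    ((intervalIntegrable_iff_integrableOn_Ioc_of_le Real.pi_pos.le).2 hint)
  rw [intervalIntegral.integral_of_le Real.pi_pos.le, integral_Ioc_eq_integral_Ioo] at hval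
  rw [← ofReal_integral_eq_lintegral_ofReal (hint.mono_set Set.Ioo_subset_Ioc_self)
    ((ae_restrict_iff' measurableSet_Ioo).2 (Filter.Eventually.of_forall hpos)), hval]
  congr 1
  have h := sum_choose_mul_sinc n (a * n)
  rw [show (1 : ℝ) + n - a * n = 1 + (1 - a) * n by ring] at h
  rw [← h, Finset.mul_sum]
  simp only [stablePathPrimitive, stablePathRadius_pi ha0 ha1, Real.one_rpow, zero_mul, mul_zero,
    Finset.sum_const_zero, sub_zero, one_mul]
  refine Finset.sum_congr rfl fun j _ => ?_
  rw [mul_comm Real.pi ((j : ℝ) - a * n)]; ring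

/-! ### The exponential law and its moments -/

theorem expMeasure_one_eq_withDensity :
    expMeasure 1 = (volume.restrict (Set.Ioi 0)).withDensity
      (fun x : ℝ => ENNReal.ofReal (Real.exp (-x))) := by
  have : expMeasure 1 = volume.withDensity (exponentialPDF 1) := rfl
  rw [this, restrict_Ioi_eq_restrict_Ici, ← withDensity_indicator measurableSet_Ici]
  congr 1
  ext x
  rw [exponentialPDF_eq, Set.indicator_apply]
  by_cases hx : 0 ≤ x <;> simp [hx]

theorem ae_expMeasure_one_pos : ∀ᵐ x ∂expMeasure 1, 0 < x := by
  rw [expMeasure_one_eq_withDensity]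
  exact (withDensity_absolutelyContinuous _ _).ae_le (ae_restrict_mem measurableSet_Ioi)

theorem lintegral_rpow_expMeasure_one {p : ℝ} (hp : 0 ≤ p) :
    ∫⁻ x, ENNReal.ofReal (x ^ p) ∂expMeasure 1 = ENNReal.ofReal (Real.Gamma (1 + p)) := by
  rw [expMeasure_one_eq_withDensity, lintegral_withDensity_eq_lintegral_mul _ (by fun_prop)
    (by fun_prop), Real.Gamma_eq_integral (by linarith),
    ofReal_integral_eq_lintegral_ofReal (Real.GammaIntegral_convergent (by linarith))
      ((ae_restrict_iff' measurableSet_Ioi).2 (Filter.Eventually.of_forall fun x hx => ?_))]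
  · refine lintegral_congr fun x => ?_
    rw [Pi.mul_apply, ← ENNReal.ofReal_mul (Real.exp_pos _).le, add_sub_cancel_left]
  · have : (0 : ℝ) < x := hx
    show 0 ≤ Real.exp (-x) * x ^ (1 + p - 1)
    positivity

theorem expMeasure_one_Ioi {x : ℝ} (hx : 0 ≤ x) :
    expMeasure 1 (Set.Ioi x) = ENNReal.ofReal (Real.exp (-x)) := by
  have := isProbabilityMeasure_expMeasure (r := 1) one_pos
  rw [← Set.compl_Iic, prob_compl_eq_one_sub measurableSet_Iic, ← ofReal_cdf,
    cdf_expMeasure_eq one_pos, if_pos hx, one_mul, ← ENNReal.ofReal_one, ← ENNReal.ofReal_sub]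
  · simp
  · simpa using hx

/-- A law on `[0, ∞)` whose moments are `n!` has exponential moments of every order `r < 1`: the
exponential series is dominated by `∑ r ^ n`. -/
theorem integrable_exp_mul_of_moments {μ : Measure ℝ} (h0 : ∀ᵐ x ∂μ, 0 ≤ x)
    (hm : ∀ n : ℕ, ∫⁻ x, ENNReal.ofReal (x ^ n) ∂μ = n.factorial) {r : ℝ} (hr : r < 1) :
    Integrable (fun x => Real.exp (r * x)) μ := by
  have key : ∀ r : ℝ, 0 ≤ r → r < 1 → Integrable (fun x => Real.exp (r * x)) μ := by
    intro r hr0 hr1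
    refine ⟨by fun_prop, ?_⟩
    rw [hasFiniteIntegral_iff_ofReal (Filter.Eventually.of_forall fun _ => (Real.exp_pos _).le)]
    have : ∫⁻ x, ENNReal.ofReal (Real.exp (r * x)) ∂μ =
        ∑' n : ℕ, ∫⁻ x, ENNReal.ofReal (r ^ n / n.factorial) * ENNReal.ofReal (x ^ n) ∂μ := by
      rw [← lintegral_tsum (fun n => by fun_prop)]
      refine lintegral_congr_ae (h0.mono fun x hx => ?_)
      simp only
      rw [Real.exp_eq_exp_ℝ, NormedSpace.exp_eq_tsum_div, ENNReal.ofReal_tsum_of_nonneg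
        (fun n => by positivity) (NormedSpace.expSeries_div_summable _)]
      congr 1
      ext n
      rw [← ENNReal.ofReal_mul (by positivity), mul_pow]
      congr 1; ring
    rw [this]
    have : ∀ n : ℕ, ∫⁻ x, ENNReal.ofReal (r ^ n / n.factorial) * ENNReal.ofReal (x ^ n) ∂μ =
        ENNReal.ofReal (r ^ n) := by
      intro n
      rw [lintegral_const_mul _ (by fun_prop), hm, ← ENNReal.ofReal_natCast,
        ← ENNReal.ofReal_mul (by positivity)]
      congr 1; field_simp
    simp only [this]
    exact (summable_geometric_of_lt_one hr0 hr1).tsum_ofReal_lt_top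
  refine (key (max r 0) (le_max_right _ _) (max_lt hr one_pos)).mono' (by fun_prop)
    (h0.mono fun x hx => ?_)
  rw [Real.norm_eq_abs, abs_of_pos (Real.exp_pos _)]
  exact Real.exp_le_exp.2 (mul_le_mul_of_nonneg_right (le_max_left _ _) hx)

/-- A law on `[0, ∞)` is determined by the moments `n!`: they are the derivatives at `0` of the
complex moment generating function, which is analytic on the half-plane `re z < 1`, and this
half-plane contains the imaginary axis. -/
theorem ext_of_moments_eq_factorial {μ ν : Measure ℝ} (hμ0 : ∀ᵐ x ∂μ, 0 ≤ x)
    (hν0 : ∀ᵐ x ∂ν, 0 ≤ x)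
    (hμ : ∀ n : ℕ, ∫⁻ x, ENNReal.ofReal (x ^ n) ∂μ = n.factorial)
    (hν : ∀ n : ℕ, ∫⁻ x, ENNReal.ofReal (x ^ n) ∂ν = n.factorial) : μ = ν := by
  have aux : ∀ ρ : Measure ℝ, (∀ᵐ x ∂ρ, 0 ≤ x) →
      (∀ n : ℕ, ∫⁻ x, ENNReal.ofReal (x ^ n) ∂ρ = n.factorial) → IsFiniteMeasure ρ ∧
      Set.Iio 1 ⊆ interior (integrableExpSet id ρ) ∧ ∀ n : ℕ, ∫ x, x ^ n ∂ρ = n.factorial := by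
    intro ρ h0 hm
    refine ⟨⟨?_⟩, ?_, fun n => ?_⟩
    · have := hm 0
      simp only [pow_zero, ENNReal.ofReal_one, lintegral_const, one_mul, Nat.factorial_zero] at this
      simp [this]
    · exact interior_maximal (fun r hr => integrable_exp_mul_of_moments h0 hm hr) isOpen_Iio
    · rw [integral_eq_lintegral_of_nonneg_ae (h0.mono fun x hx => pow_nonneg hx n) (by fun_prop), hm]
      simp
  obtain ⟨_, hμi, hμm⟩ := aux μ hμ0 hμ
  obtain ⟨_, hνi, hνm⟩ := aux ν hν0 hν
  have hanal : ∀ ρ : Measure ℝ, Set.Iio 1 ⊆ interior (integrableExpSet id ρ) →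
      AnalyticOnNhd ℂ (complexMGF id ρ) {z | z.re < 1} := fun ρ h =>
    analyticOnNhd_complexMGF.mono fun z hz => h hz
  have hder : ∀ ρ : Measure ℝ, Set.Iio 1 ⊆ interior (integrableExpSet id ρ) →
      (∀ n : ℕ, ∫ x, x ^ n ∂ρ = n.factorial) → ∀ n : ℕ,
      iteratedDeriv n (complexMGF id ρ) 0 = n.factorial := by
    intro ρ h hm n
    rw [iteratedDeriv_complexMGF (h (by simp))]
    simp only [id_eq, zero_mul, Complex.exp_zero, mul_one]
    have := hm n
    rw [← Complex.ofReal_natCast, ← this, ← integral_complex_ofReal]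
    simp
  have hnhds : complexMGF id μ =ᶠ[nhds 0] complexMGF id ν := by
    have h1 := (hanal μ hμi 0 (by simp)).hasFPowerSeriesAt
    have h2 := (hanal ν hνi 0 (by simp)).hasFPowerSeriesAt
    simp only [hder μ hμi hμm, hder ν hνi hνm] at h1 h2
    have h3 := h1.sub h2
    rw [sub_self] at h3
    exact h3.eventually_eq_zero.mono fun z hz => sub_eq_zero.1 hz
  have heq := (hanal μ hμi).eqOn_of_preconnected_of_eventuallyEq (hanal ν hνi)
    (convex_halfSpace_re_lt 1).isPreconnected (by simp) hnhds
  refine Measure.ext_of_charFun (funext fun t => ?_)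
  rw [← complexMGF_id_mul_I, ← complexMGF_id_mul_I]
  exact heq (by simp)

/-- If `𝔼[X ^ (-a n)] = n! / Γ(1 + a n)` for all natural `n`, then `X` has the Laplace transform
`exp (-s ^ a)`. Indeed `(E / X) ^ a` is then standard exponential for an independent standard
exponential `E`, and the Laplace transform at `s` is the probability that `E > s X`. -/
theorem lintegral_exp_neg_mul_of_moments {a : ℝ} (ha : 0 < a) {ρ : Measure ℝ}
    [IsProbabilityMeasure ρ] (h0 : ∀ᵐ x ∂ρ, 0 < x)
    (hm : ∀ n : ℕ, ∫⁻ x, ENNReal.ofReal (x ^ (-(a * n))) ∂ρ =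
      ENNReal.ofReal (n.factorial * (Real.Gamma (1 + a * n))⁻¹)) {s : ℝ} (hs : 0 ≤ s) :
    ∫⁻ x, ENNReal.ofReal (Real.exp (-(s * x))) ∂ρ = ENNReal.ofReal (Real.exp (-s ^ a)) := by
  have hexp := isProbabilityMeasure_expMeasure (r := 1) one_pos
  set η := expMeasure 1 with hη
  set Y : ℝ × ℝ → ℝ := fun p => (p.1 / p.2) ^ a with hY
  have hYm : Measurable Y := by fun_prop
  have hpos : ∀ᵐ p ∂η.prod ρ, 0 < p.1 ∧ 0 < p.2 :=
    (Measure.quasiMeasurePreserving_fst.ae ae_expMeasure_one_pos).and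
      (Measure.quasiMeasurePreserving_snd.ae h0)
  have hlaw : (η.prod ρ).map Y = η := by
    refine ext_of_moments_eq_factorial ?_ (ae_expMeasure_one_pos.mono fun _ h => h.le) ?_ ?_
    · rw [ae_map_iff hYm.aemeasurable measurableSet_Ici]
      exact hpos.mono fun p hp => Real.rpow_nonneg (div_pos hp.1 hp.2).le _
    · intro n
      rw [lintegral_map (by fun_prop) hYm]
      have : ∀ᵐ p ∂η.prod ρ, ENNReal.ofReal (Y p ^ n) =
          ENNReal.ofReal (p.1 ^ (a * n)) * ENNReal.ofReal (p.2 ^ (-(a * n))) := by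
        filter_upwards [hpos] with p hp
        rw [← ENNReal.ofReal_mul (Real.rpow_nonneg hp.1.le _), hY]
        simp only
        rw [← Real.rpow_natCast, ← Real.rpow_mul (div_pos hp.1 hp.2).le,
          Real.div_rpow hp.1.le hp.2.le, Real.rpow_neg hp.2.le, div_eq_mul_inv]
      rw [lintegral_congr_ae this,
        lintegral_prod_mul (f := fun x : ℝ => ENNReal.ofReal (x ^ (a * n)))
          (g := fun x : ℝ => ENNReal.ofReal (x ^ (-(a * n)))) (by fun_prop) (by fun_prop), hm, hη,
        lintegral_rpow_expMeasure_one (by positivity),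
        ← ENNReal.ofReal_mul (Real.Gamma_pos_of_pos (by positivity)).le, mul_left_comm,
        mul_inv_cancel₀ (Real.Gamma_pos_of_pos (by positivity)).ne', mul_one,
        ENNReal.ofReal_natCast]
    · intro n
      have := lintegral_rpow_expMeasure_one (p := n) (by positivity)
      simp only [Real.rpow_natCast] at this
      rw [hη, this, add_comm, Real.Gamma_nat_eq_factorial, ENNReal.ofReal_natCast]
  have htail : (η.prod ρ) (Y ⁻¹' Set.Ioi (s ^ a)) = ENNReal.ofReal (Real.exp (-s ^ a)) := by
    rw [← Measure.map_apply hYm measurableSet_Ioi, hlaw, hη,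
      expMeasure_one_Ioi (Real.rpow_nonneg hs _)]
  rw [← htail, Measure.prod_apply_symm (hYm measurableSet_Ioi)]
  refine lintegral_congr_ae (h0.mono fun x hx => ?_)
  simp only
  rw [← expMeasure_one_Ioi (by positivity), ← hη]
  refine measure_congr (ae_expMeasure_one_pos.mono fun e he => ?_)
  refine propext ?_
  change s * x < e ↔ s ^ a < (e / x) ^ a
  rw [Real.rpow_lt_rpow_iff hs (div_pos he hx).le ha, lt_div_iff₀ hx]

/-! ### Laplace transform of the scaling variable -/

theorem stableScale_two {θ : ℝ} (w : ℝ) (hθ : θ ∈ Set.Ioo (-(Real.pi / 2)) (Real.pi / 2)) :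
    stableScale 2 w θ = 1 := by
  have := (Real.cos_pos_of_mem_Ioo hθ).ne'
  have e : Real.sin (2 * Real.pi / 4 + 2 / 2 * θ) = Real.cos θ := by
    rw [← Real.sin_add_pi_div_two]; congr 1; ring
  rw [stableScale, e]
  simp [this]

/-- Kanter's form of the scaling variable, in the angle `φ = θ + π / 2`. -/
theorem stableScale_two_mul {a : ℝ} (ha : a ≠ 0) (w θ : ℝ) :
    stableScale (2 * a) w θ =
      Real.sin (a * (θ + Real.pi / 2)) / Real.sin (θ + Real.pi / 2) ^ (1 / a) *
        (Real.sin ((1 - a) * (θ + Real.pi / 2)) / w) ^ (1 / a - 1) := by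
  have e1 : Real.cos (2 * a * Real.pi / 4 + (2 * a / 2 - 1) * θ) =
      Real.sin ((1 - a) * (θ + Real.pi / 2)) := by
    rw [← Real.sin_pi_div_two_sub]; congr 1; ring
  rw [stableScale, e1, Real.sin_add_pi_div_two, show 2 / (2 * a) = 1 / a by field_simp]
  congr 3
  ring

theorem stableScale_two_mul_pos {a w θ : ℝ} (ha0 : 0 < a) (ha1 : a < 1) (hw : 0 < w)
    (hθ : θ ∈ Set.Ioo (-(Real.pi / 2)) (Real.pi / 2)) : 0 < stableScale (2 * a) w θ := by
  have h0 : 0 < θ + Real.pi / 2 := by linarith [hθ.1]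
  have h1 : θ + Real.pi / 2 < Real.pi := by linarith [hθ.2]
  have := sin_mul_pos ha0 ha1.le h0 h1
  have := sin_mul_pos (a := 1 - a) (by linarith) (by linarith) h0 h1
  have := Real.sin_pos_of_pos_of_lt_pi h0 h1
  rw [stableScale_two_mul ha0.ne']
  positivity

theorem stableScale_two_mul_rpow_neg {a w θ : ℝ} (ha0 : 0 < a) (ha1 : a < 1) (hw : 0 < w)
    (hθ : θ ∈ Set.Ioo (-(Real.pi / 2)) (Real.pi / 2)) (n : ℕ) :
    stableScale (2 * a) w θ ^ (-(a * n)) =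
      w ^ ((1 - a) * n) * stablePathIntegrand a n (θ + Real.pi / 2) := by
  have h0 : 0 < θ + Real.pi / 2 := by linarith [hθ.1]
  have h1 : θ + Real.pi / 2 < Real.pi := by linarith [hθ.2]
  rw [stableScale_two_mul ha0.ne', stablePathIntegrand, stablePathRadius_eq h0.ne']
  have hx := sin_mul_pos ha0 ha1.le h0 h1
  have hy := sin_mul_pos (a := 1 - a) (by linarith) (by linarith) h0 h1
  have hz := Real.sin_pos_of_pos_of_lt_pi h0 h1
  generalize Real.sin (a * (θ + Real.pi / 2)) = x at *
  generalize Real.sin ((1 - a) * (θ + Real.pi / 2)) = y at *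
  generalize Real.sin (θ + Real.pi / 2) = z at *
  -- Both sides are products of powers of positive numbers: compare logarithms.
  rw [← Real.rpow_natCast, ← Real.exp_log (show 0 < x / z ^ (1 / a) * (y / w) ^ (1 / a - 1) by
      positivity),
    ← Real.exp_log (show 0 < x / y by positivity), ← Real.exp_log (show 0 < z / y by positivity),
    ← Real.exp_mul, ← Real.exp_mul, ← Real.exp_mul, Real.log_mul (by positivity) (by positivity),
    Real.log_div (by positivity) (by positivity), Real.log_rpow hz,
    Real.log_rpow (by positivity), Real.log_div hy.ne' hw.ne', Real.log_div hx.ne' hy.ne',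
    Real.log_div hz.ne' hy.ne', Real.rpow_def_of_pos hw, ← Real.exp_add, ← Real.exp_add]
  congr 1
  field_simp
  ring

theorem measurable_stablePathIntegrand (a : ℝ) (n : ℕ) : Measurable (stablePathIntegrand a n) := by
  unfold stablePathIntegrand stablePathRadius
  have := Real.continuous_sinc.measurable
  fun_prop

theorem measurable_stableScale (α : ℝ) :
    Measurable fun p : ℝ × ℝ => stableScale α p.1 p.2 := by
  unfold stableScale
  fun_prop

section
variable {Ω : Type*} [MeasurableSpace Ω] {P : Measure Ω} {W Θ : Ω → ℝ}

theorem volume_Icc_pi_div_two :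
    (volume (Set.Icc (-(Real.pi / 2)) (Real.pi / 2)) : ENNReal) = ENNReal.ofReal Real.pi := by
  rw [Real.volume_Icc]; congr 1; ring

theorem aemeasurable_of_isUniform
    (hΘ : pdf.IsUniform Θ (Set.Icc (-(Real.pi / 2)) (Real.pi / 2)) P) : AEMeasurable Θ P :=
  hΘ.aemeasurable (by simp [Real.pi_pos]) (by simp)

theorem ae_mem_Ioo_of_isUniform
    (hΘ : pdf.IsUniform Θ (Set.Icc (-(Real.pi / 2)) (Real.pi / 2)) P) :
    ∀ᵐ ω ∂P, Θ ω ∈ Set.Ioo (-(Real.pi / 2)) (Real.pi / 2) := by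
  have h : ∀ᵐ x ∂P.map Θ, x ∈ Set.Ioo (-(Real.pi / 2)) (Real.pi / 2) := by
    rw [hΘ, ProbabilityTheory.cond, ← Measure.restrict_congr_set Ioo_ae_eq_Icc]
    exact Measure.ae_smul_measure (ae_restrict_mem measurableSet_Ioo) _
  exact ae_of_ae_map (aemeasurable_of_isUniform hΘ) h

theorem ae_pos_of_hasLaw_expMeasure (hW : HasLaw W (expMeasure 1) P) : ∀ᵐ ω ∂P, 0 < W ω :=
  (ae_of_ae_map hW.aemeasurable (hW.map_eq ▸ ae_expMeasure_one_pos) :)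

/-- The angle `Θ + π / 2` is uniform on `(0, π)`. -/
theorem lintegral_isUniform (hΘ : pdf.IsUniform Θ (Set.Icc (-(Real.pi / 2)) (Real.pi / 2)) P)
    {f : ℝ → ENNReal} (hf : Measurable f) :
    ∫⁻ ω, f (Θ ω + Real.pi / 2) ∂P =
      (ENNReal.ofReal Real.pi)⁻¹ * ∫⁻ φ in Set.Ioo 0 Real.pi, f φ := by
  rw [← lintegral_map' (f := fun x => f (x + Real.pi / 2)) (by fun_prop)
    (aemeasurable_of_isUniform hΘ), hΘ, ProbabilityTheory.cond, lintegral_smul_measure, volume_Icc_pi_div_two,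
    smul_eq_mul, ← Measure.restrict_congr_set Ioo_ae_eq_Icc]
  congr 1
  have h := (measurePreserving_add_right (volume : Measure ℝ) (Real.pi / 2)).setLIntegral_comp_preimage
    (s := Set.Ioo 0 Real.pi) measurableSet_Ioo hf
  rw [← h]
  congr 2
  ext x
  simp only [Set.mem_Ioo, Set.mem_preimage]
  constructor <;> rintro ⟨h1, h2⟩ <;> constructor <;> linarith

theorem ae_stableScale_pos {α : ℝ} (hα₀ : 0 < α) (hα₂ : α ≤ 2)
    (hW : HasLaw W (expMeasure 1) P)
    (hΘ : pdf.IsUniform Θ (Set.Icc (-(Real.pi / 2)) (Real.pi / 2)) P) :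
    ∀ᵐ ω ∂P, 0 < stableScale α (W ω) (Θ ω) := by
  filter_upwards [ae_pos_of_hasLaw_expMeasure hW, ae_mem_Ioo_of_isUniform hΘ] with ω hw hθ
  rcases hα₂.eq_or_lt with rfl | h
  · rw [stableScale_two _ hθ]; exact one_pos
  · have := stableScale_two_mul_pos (a := α / 2) (by linarith) (by linarith) hw hθ
    rwa [mul_div_cancel₀ _ two_ne_zero] at this

theorem ae_stableScale_two_eq_one
    (hΘ : pdf.IsUniform Θ (Set.Icc (-(Real.pi / 2)) (Real.pi / 2)) P) :
    ∀ᵐ ω ∂P, stableScale 2 (W ω) (Θ ω) = 1 :=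
  (ae_mem_Ioo_of_isUniform hΘ).mono fun _ h => stableScale_two _ h

/-- The negative moments `𝔼[A ^ (-a n)] = n! / Γ(1 + a n)` of the scaling variable. -/
theorem lintegral_stableScale_rpow_neg {a : ℝ} (ha0 : 0 < a) (ha1 : a < 1)
    (hW : HasLaw W (expMeasure 1) P)
    (hΘ : pdf.IsUniform Θ (Set.Icc (-(Real.pi / 2)) (Real.pi / 2)) P)
    (hind : IndepFun W Θ P) (n : ℕ) :
    ∫⁻ ω, ENNReal.ofReal (stableScale (2 * a) (W ω) (Θ ω) ^ (-(a * n))) ∂P =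
      ENNReal.ofReal (n.factorial * (Real.Gamma (1 + a * n))⁻¹) := by
  have hmeas := measurable_stablePathIntegrand a n
  have h1a : 0 ≤ (1 - a) * n := mul_nonneg (by linarith) (by positivity)
  have hae : ∀ᵐ ω ∂P, ENNReal.ofReal (stableScale (2 * a) (W ω) (Θ ω) ^ (-(a * n))) =
      ENNReal.ofReal (W ω ^ ((1 - a) * n)) *
        ENNReal.ofReal (stablePathIntegrand a n (Θ ω + Real.pi / 2)) := by
    filter_upwards [ae_pos_of_hasLaw_expMeasure hW, ae_mem_Ioo_of_isUniform hΘ] with ω hw hθ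
    rw [stableScale_two_mul_rpow_neg ha0 ha1 hw hθ, ENNReal.ofReal_mul (by positivity)]
  have hG1 : 0 < Real.Gamma (1 + (1 - a) * n) := Real.Gamma_pos_of_pos (by linarith)
  have hG2 : 0 < Real.Gamma (1 + a * n) := Real.Gamma_pos_of_pos (by positivity)
  have hΘm := aemeasurable_of_isUniform hΘ
  have hWm := hW.aemeasurable
  have hind' : IndepFun (fun ω => ENNReal.ofReal (W ω ^ ((1 - a) * n)))
      (fun ω => ENNReal.ofReal (stablePathIntegrand a n (Θ ω + Real.pi / 2))) P :=
    hind.comp (φ := fun w => ENNReal.ofReal (w ^ ((1 - a) * n)))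
      (ψ := fun θ => ENNReal.ofReal (stablePathIntegrand a n (θ + Real.pi / 2)))
      (by fun_prop) (by fun_prop)
  have hψ : Measurable fun x : ℝ => ENNReal.ofReal (stablePathIntegrand a n (x + Real.pi / 2)) := by
    fun_prop
  have hmul := lintegral_mul_eq_lintegral_mul_lintegral_of_indepFun' (by fun_prop)
    (hψ.comp_aemeasurable hΘm) hind'
  simp only [Pi.mul_apply, Function.comp_apply] at hmul
  have e1 : ∫⁻ ω, ENNReal.ofReal (W ω ^ ((1 - a) * n)) ∂P =
      ENNReal.ofReal (Real.Gamma (1 + (1 - a) * n)) := by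
    rw [← lintegral_rpow_expMeasure_one h1a, ← hW.map_eq, lintegral_map' (by fun_prop) hWm]
  rw [lintegral_congr_ae hae, hmul, e1,
    lintegral_isUniform hΘ (f := fun φ => ENNReal.ofReal (stablePathIntegrand a n φ))
    (by fun_prop), lintegral_stablePathIntegrand ha0 ha1, ← ENNReal.ofReal_inv_of_pos Real.pi_pos,
    ← ENNReal.ofReal_mul (by positivity), ← ENNReal.ofReal_mul hG1.le]
  congr 1
  field_simp

theorem aemeasurable_stableScale (α : ℝ) (hW : AEMeasurable W P) (hΘ : AEMeasurable Θ P) :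
    AEMeasurable (fun ω => stableScale α (W ω) (Θ ω)) P := by
  have h := (measurable_stableScale α).comp_aemeasurable (hW.prodMk hΘ)
  exact h

theorem lintegral_exp_neg_mul_map_stableScale {α : ℝ} (hα₀ : 0 < α) (hα₂ : α ≤ 2)
    [IsProbabilityMeasure P] (hW : HasLaw W (expMeasure 1) P)
    (hΘ : pdf.IsUniform Θ (Set.Icc (-(Real.pi / 2)) (Real.pi / 2)) P)
    (hind : IndepFun W Θ P) {s : ℝ} (hs : 0 ≤ s) :
    ∫⁻ x, ENNReal.ofReal (Real.exp (-(s * x))) ∂P.map (fun ω => stableScale α (W ω) (Θ ω)) =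
      ENNReal.ofReal (Real.exp (-s ^ (α / 2))) := by
  have hA := aemeasurable_stableScale α hW.aemeasurable (aemeasurable_of_isUniform hΘ)
  have hpos := ae_stableScale_pos hα₀ hα₂ hW hΘ
  rcases hα₂.eq_or_lt with rfl | h
  · have : ∀ᵐ ω ∂P, ENNReal.ofReal (Real.exp (-(s * stableScale 2 (W ω) (Θ ω)))) =
        ENNReal.ofReal (Real.exp (-s)) :=
      (ae_stableScale_two_eq_one hΘ).mono fun ω hω => by rw [hω, mul_one]
    rw [lintegral_map' (by fun_prop) hA, lintegral_congr_ae this]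
    simp
  · have hm := lintegral_stableScale_rpow_neg (a := α / 2) (by linarith) (by linarith) hW hΘ hind
    rw [mul_div_cancel₀ _ two_ne_zero] at hm
    have := Measure.isProbabilityMeasure_map hA
    refine lintegral_exp_neg_mul_of_moments (by linarith) ?_ (fun n => ?_) hs
    · exact (ae_map_iff hA measurableSet_Ioi).2 hpos
    · rw [lintegral_map' (by fun_prop) hA]
      exact hm n
end

/-! ### Characteristic function of a law with Laplace transform `exp (-s ^ a)` -/

theorem mgf_neg_of_laplace {a : ℝ} {ρ : Measure ℝ} 
    (hL : ∀ s : ℝ, 0 ≤ s →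
      ∫⁻ x, ENNReal.ofReal (Real.exp (-(s * x))) ∂ρ = ENNReal.ofReal (Real.exp (-s ^ a)))
    {s : ℝ} (hs : 0 ≤ s) :
    Integrable (fun x => Real.exp (-s * x)) ρ ∧ mgf id ρ (-s) = Real.exp (-s ^ a) := by
  have h := hL s hs
  simp only [← neg_mul] at h
  constructor
  · refine ⟨by fun_prop, ?_⟩
    rw [hasFiniteIntegral_iff_ofReal (Filter.Eventually.of_forall fun _ => (Real.exp_pos _).le), h]
    exact ENNReal.ofReal_lt_top
  · simp only [mgf, id_eq]
    rw [integral_eq_lintegral_of_nonneg_ae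
      (Filter.Eventually.of_forall fun _ => (Real.exp_pos _).le) (by fun_prop), h,
      ENNReal.toReal_ofReal (Real.exp_pos _).le]

/-- Analytic continuation of the Laplace transform from the negative half-line to the half-plane
`re z < 0`, with the principal branch of the power. -/
theorem complexMGF_eq_of_laplace {a : ℝ} {ρ : Measure ℝ} 
    (hL : ∀ s : ℝ, 0 ≤ s →
      ∫⁻ x, ENNReal.ofReal (Real.exp (-(s * x))) ∂ρ = ENNReal.ofReal (Real.exp (-s ^ a)))
    {z : ℂ} (hz : z.re < 0) :
    complexMGF id ρ z = Complex.exp (-(-z) ^ (a : ℂ)) := by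
  have hsub : Set.Iio 0 ⊆ interior (integrableExpSet id ρ) :=
    interior_maximal (fun r hr => by
      have := (mgf_neg_of_laplace hL (s := -r) (by linarith [Set.mem_Iio.1 hr])).1
      rwa [neg_neg] at this) isOpen_Iio
  have h1 : AnalyticOnNhd ℂ (complexMGF id ρ) {z | z.re < 0} :=
    analyticOnNhd_complexMGF.mono fun z hz => hsub hz
  have hopen : IsOpen {z : ℂ | z.re < 0} := isOpen_lt Complex.continuous_re continuous_const
  have h2 : AnalyticOnNhd ℂ (fun z : ℂ => Complex.exp (-(-z) ^ (a : ℂ))) {z | z.re < 0} := by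
    refine DifferentiableOn.analyticOnNhd (fun z hz => ?_) hopen
    have hs : -z ∈ Complex.slitPlane := Or.inl (by simpa using hz)
    have : DifferentiableAt ℂ (fun z : ℂ => (-z) ^ (a : ℂ)) z :=
      differentiableAt_id.neg.cpow_const hs
    exact this.neg.cexp.differentiableWithinAt
  refine h1.eqOn_of_preconnected_of_frequently_eq h2 (convex_halfSpace_re_lt 0).isPreconnected
    (z₀ := ((-1 : ℝ) : ℂ)) (by simp) ?_ hz
  have hmap : Filter.Tendsto (fun x : ℝ => (x : ℂ)) (nhdsWithin (-1) {-1}ᶜ)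
      (nhdsWithin ((-1 : ℝ) : ℂ) {((-1 : ℝ) : ℂ)}ᶜ) := by
    refine tendsto_nhdsWithin_iff.2 ⟨?_, ?_⟩
    · exact Complex.continuous_ofReal.continuousAt.tendsto.mono_left nhdsWithin_le_nhds
    · exact eventually_mem_nhdsWithin.mono fun x hx h => hx (Complex.ofReal_injective h)
  refine hmap.frequently (Filter.Eventually.frequently ?_)
  filter_upwards [nhdsWithin_le_nhds (Iio_mem_nhds (show (-1 : ℝ) < 0 by norm_num))] with x hx
  have hx : x < 0 := hx
  have := (mgf_neg_of_laplace hL (s := -x) (by linarith)).2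
  rw [neg_neg] at this
  rw [complexMGF_ofReal, this, ← Complex.ofReal_neg, ← Complex.ofReal_cpow (by linarith)]
  push_cast; rfl

/-- The characteristic function is the boundary value of the Laplace transform, again with the
principal branch. -/
theorem charFun_eq_of_laplace {a : ℝ} (ha : 0 < a) {ρ : Measure ℝ} [IsProbabilityMeasure ρ]
    (h0 : ∀ᵐ x ∂ρ, 0 < x)
    (hL : ∀ s : ℝ, 0 ≤ s →
      ∫⁻ x, ENNReal.ofReal (Real.exp (-(s * x))) ∂ρ = ENNReal.ofReal (Real.exp (-s ^ a)))
    (t : ℝ) : charFun ρ t = Complex.exp (-(-(t * Complex.I)) ^ (a : ℂ)) := by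
  by_cases ht : t = 0
  · simp [ht, Complex.zero_cpow (show (a : ℂ) ≠ 0 by exact_mod_cast ha.ne')]
  rw [← complexMGF_id_mul_I]
  -- Approach `t * I` from the left half-plane. For `t ≠ 0` the limit of `-z` is off the branch cut.
  set γ : ℝ → ℂ := fun ε => t * Complex.I - ε with hγ
  have hγlim : Filter.Tendsto γ (nhdsWithin 0 (Set.Ioi 0)) (nhds (t * Complex.I)) := by
    have : Continuous γ := by fun_prop
    have := this.tendsto 0
    simp only [hγ, Complex.ofReal_zero, sub_zero] at this
    exact this.mono_left nhdsWithin_le_nhds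
  have h1 : Filter.Tendsto (fun ε => complexMGF id ρ (γ ε)) (nhdsWithin 0 (Set.Ioi 0))
      (nhds (complexMGF id ρ (t * Complex.I))) := by
    refine tendsto_integral_filter_of_dominated_convergence (fun _ => 1)
      (Filter.Eventually.of_forall fun ε => by fun_prop) ?_ (integrable_const 1)
      (Filter.Eventually.of_forall fun x => ?_)
    · filter_upwards [self_mem_nhdsWithin] with ε hε
      filter_upwards [h0] with x hx
      have hε : 0 < ε := hε
      rw [Complex.norm_exp, Real.exp_le_one_iff]
      simp [hγ]
      positivity
    · exact (Complex.continuous_exp.tendsto _).comp (hγlim.mul_const _)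
  have h2 : Filter.Tendsto (fun ε => Complex.exp (-(-(γ ε)) ^ (a : ℂ))) (nhdsWithin 0 (Set.Ioi 0))
      (nhds (Complex.exp (-(-(t * Complex.I)) ^ (a : ℂ)))) := by
    have hc : ContinuousAt (fun z : ℂ => Complex.exp (-(-z) ^ (a : ℂ))) (t * Complex.I) := by
      have hs : -(t * Complex.I) ∈ Complex.slitPlane := Or.inr (by simpa using ht)
      have : DifferentiableAt ℂ (fun z : ℂ => (-z) ^ (a : ℂ)) (t * Complex.I) :=
        differentiableAt_id.neg.cpow_const hs
      exact this.neg.cexp.continuousAt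
    exact hc.tendsto.comp hγlim
  refine tendsto_nhds_unique h1 (h2.congr' ?_)
  filter_upwards [self_mem_nhdsWithin] with ε hε
  rw [complexMGF_eq_of_laplace hL]
  simpa [hγ] using hε

theorem neg_cpow_eq_stableExponent {a : ℝ} (ha0 : 0 < a) (ha1 : a < 1) (t : ℝ) :
    -(-(t * Complex.I)) ^ (a : ℂ) =
      stableExponent a (Real.cos (Real.pi * a / 2) ^ (1 / a)) 1 0 t := by
  have hcos : 0 < Real.cos (Real.pi * a / 2) :=
    Real.cos_pos_of_mem_Ioo ⟨by nlinarith [Real.pi_pos], by nlinarith [Real.pi_pos]⟩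
  rw [stableExponent, if_neg ha1.ne, ← Real.rpow_mul hcos.le, one_div, inv_mul_cancel₀ ha0.ne',
    Real.rpow_one]
  by_cases ht : t = 0
  · simp [ht, Complex.zero_cpow (show (a : ℂ) ≠ 0 by exact_mod_cast ha0.ne'),
      Real.zero_rpow ha0.ne']
  have harg : Complex.arg (-(t * Complex.I)) = -(Real.sign t * (Real.pi / 2)) := by
    rcases lt_or_gt_of_ne ht with h | h
    · rw [Real.sign_of_neg h, show -((t : ℂ) * Complex.I) = ((-t : ℝ) : ℂ) * Complex.I by
        push_cast; ring, Complex.arg_real_mul _ (by linarith), Complex.arg_I]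
      ring
    · rw [Real.sign_of_pos h, show -((t : ℂ) * Complex.I) = ((t : ℝ) : ℂ) * -Complex.I by
        ring, Complex.arg_real_mul _ h, Complex.arg_neg_I]
      ring
  have hnorm : ‖-((t : ℂ) * Complex.I)‖ = |t| := by simp
  have hne : -((t : ℂ) * Complex.I) ≠ 0 := by simp [ht]
  have hsin : Real.sin (Real.pi * a / 2) =
      Real.tan (Real.pi * a / 2) * Real.cos (Real.pi * a / 2) := by
    rw [Real.tan_mul_cos hcos.ne']
  have hs : Real.cos (-(Real.sign t * (Real.pi / 2)) * a) = Real.cos (Real.pi * a / 2) ∧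
      Real.sin (-(Real.sign t * (Real.pi / 2)) * a) =
        -(Real.sign t * Real.sin (Real.pi * a / 2)) := by
    rcases lt_or_gt_of_ne ht with h | h
    · rw [Real.sign_of_neg h]
      rw [show -(-1 * (Real.pi / 2)) * a = Real.pi * a / 2 by ring]; simp
    · rw [Real.sign_of_pos h]
      rw [show -(1 * (Real.pi / 2)) * a = -(Real.pi * a / 2) by ring]; simp
  have hpow := Complex.cpow_ofReal (-((t : ℂ) * Complex.I)) a
  rw [hpow, hnorm, harg, hs.1, hs.2, hsin]
  push_cast
  ring

/-! ### Simulation of the auxiliary variables -/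

section
variable {Ω : Type*} [MeasurableSpace Ω] {P : Measure Ω}

theorem hasLaw_neg_log_of_isUniform {U : Ω → ℝ} (hU : pdf.IsUniform U (Set.Icc 0 1) P) :
    HasLaw (fun ω => -Real.log (U ω)) (expMeasure 1) P := by
  have hexp := isProbabilityMeasure_expMeasure (r := 1) one_pos
  have hUm : AEMeasurable U P := hU.aemeasurable (by simp) (by simp)
  have hlog : Measurable fun u : ℝ => -Real.log u := by fun_prop
  have hlaw : P.map U = volume.restrict (Set.Ioo 0 1) := by
    rw [hU, ProbabilityTheory.cond, ← Measure.restrict_congr_set Ioo_ae_eq_Icc]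
    simp
  have hmap : P.map (fun ω => -Real.log (U ω)) = (P.map U).map fun u => -Real.log u :=
    (AEMeasurable.map_map_of_aemeasurable hlog.aemeasurable hUm).symm
  have hfin : IsFiniteMeasure (P.map fun ω => -Real.log (U ω)) := by
    rw [hmap, hlaw]; infer_instance
  refine ⟨hlog.comp_aemeasurable hUm, Measure.ext_of_Iic _ _ fun x => ?_⟩
  have hset : (fun u : ℝ => -Real.log u) ⁻¹' Set.Iic x ∩ Set.Ioo 0 1 =
      Set.Ico (Real.exp (-x)) 1 := by
    ext u
    simp only [Set.mem_inter_iff, Set.mem_preimage, Set.mem_Iic, Set.mem_Ioo, Set.mem_Ico]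
    constructor
    · rintro ⟨h, h0, h1⟩
      exact ⟨(Real.le_log_iff_exp_le h0).1 (by linarith), h1⟩
    · rintro ⟨h, h1⟩
      have h0 := (Real.exp_pos _).trans_le h
      exact ⟨by linarith [(Real.le_log_iff_exp_le h0).2 h], h0, h1⟩
  rw [hmap, hlaw, Measure.map_apply hlog measurableSet_Iic,
    Measure.restrict_apply (hlog measurableSet_Iic), hset, Real.volume_Ico, ← ofReal_cdf,
    cdf_expMeasure_eq one_pos]
  split_ifs with h
  · rw [one_mul]
  · rw [ENNReal.ofReal_zero, ENNReal.ofReal_eq_zero, sub_nonpos]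
    exact Real.one_le_exp (by linarith)

theorem isUniform_pi_mul_sub_half {U : Ω → ℝ} (hU : pdf.IsUniform U (Set.Icc 0 1) P) :
    pdf.IsUniform (fun ω => Real.pi * (U ω - 1 / 2))
      (Set.Icc (-(Real.pi / 2)) (Real.pi / 2)) P := by
  have hUm : AEMeasurable U P := hU.aemeasurable (by simp) (by simp)
  have hT : Measurable fun u : ℝ => Real.pi * (u - 1 / 2) := by fun_prop
  have hmap : P.map (fun ω => Real.pi * (U ω - 1 / 2)) =
      (P.map U).map fun u => Real.pi * (u - 1 / 2) :=
    (AEMeasurable.map_map_of_aemeasurable hT.aemeasurable hUm).symm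
  have hpre : Set.Icc (0 : ℝ) 1 =
      (fun u : ℝ => Real.pi * (u - 1 / 2)) ⁻¹' Set.Icc (-(Real.pi / 2)) (Real.pi / 2) := by
    ext u
    simp only [Set.mem_Icc, Set.mem_preimage]
    constructor
    · rintro ⟨h0, h1⟩
      constructor <;> nlinarith [Real.pi_pos]
    · rintro ⟨h0, h1⟩
      constructor <;> nlinarith [Real.pi_pos]
  have hvol : (volume : Measure ℝ).map (fun u => Real.pi * (u - 1 / 2)) =
      (ENNReal.ofReal Real.pi)⁻¹ • volume := by
    have h1 := (measurePreserving_sub_right (volume : Measure ℝ) (1 / 2)).map_eq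
    have h2 := Real.map_volume_mul_left Real.pi_ne_zero
    rw [abs_of_pos (inv_pos.2 Real.pi_pos), ENNReal.ofReal_inv_of_pos Real.pi_pos] at h2
    rw [← h2]
    conv_rhs => rw [← h1]
    rw [Measure.map_map (by fun_prop) (by fun_prop)]
    rfl
  have hlaw : P.map U = volume.restrict (Set.Icc 0 1) := by
    rw [hU, ProbabilityTheory.cond]
    simp
  rw [pdf.IsUniform, hmap, hlaw, hpre, ← Measure.restrict_map hT measurableSet_Icc, hvol,
    ProbabilityTheory.cond, volume_Icc_pi_div_two, Measure.restrict_smul]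

/-! ### Gaussian scale mixtures -/

/-- The characteristic function of `√(2A) N` is `u ↦ 𝔼[exp (-A ‖u‖²)]`. -/
theorem charFun_gaussian_scale_mixture [IsProbabilityMeasure P] {E : Type*}
    [NormedAddCommGroup E] [InnerProductSpace ℝ E] [FiniteDimensional ℝ E] [MeasurableSpace E]
    [BorelSpace E] {A : Ω → ℝ} {N : Ω → E} (hA : AEMeasurable A P) (hA0 : ∀ᵐ ω ∂P, 0 < A ω)
    (hN : HasLaw N (stdGaussian E) P) (hind : IndepFun A N P) (u : E) :
    charFun (P.map fun ω => Real.sqrt (2 * A ω) • N ω) u =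
      ((∫ x, Real.exp (-(‖u‖ ^ 2 * x)) ∂P.map A : ℝ) : ℂ) := by
  have := Measure.isProbabilityMeasure_map hA
  have hNm := hN.aemeasurable
  have hg : Measurable fun p : ℝ × E => Real.sqrt (2 * p.1) • p.2 := by fun_prop
  have hprod := (indepFun_iff_map_prod_eq_prod_map_map hA hNm).1 hind
  have hmap : P.map (fun ω => Real.sqrt (2 * A ω) • N ω) =
      ((P.map A).prod (stdGaussian E)).map fun p : ℝ × E => Real.sqrt (2 * p.1) • p.2 := by
    rw [← hN.map_eq, ← hprod, AEMeasurable.map_map_of_aemeasurable hg.aemeasurable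
      (hA.prodMk hNm)]
    rfl
  rw [hmap, charFun_apply, integral_map hg.aemeasurable (by fun_prop), integral_prod,
    ← integral_complex_ofReal]
  · refine integral_congr_ae ?_
    have h0 : ∀ᵐ x ∂P.map A, 0 < x := (ae_map_iff hA measurableSet_Ioi).2 hA0
    filter_upwards [h0] with x hx
    have h := charFun_stdGaussian (E := E) (Real.sqrt (2 * x) • u)
    rw [charFun_apply] at h
    simp only [real_inner_smul_left, real_inner_smul_right] at h ⊢
    rw [h, norm_smul, Real.norm_eq_abs, abs_of_nonneg (Real.sqrt_nonneg _)]
    push_cast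
    congr 1
    have hsq : ((Real.sqrt (2 * x) : ℝ) : ℂ) ^ 2 = 2 * x := by
      rw [← Complex.ofReal_pow, Real.sq_sqrt (by positivity)]; push_cast; ring
    rw [mul_pow, hsq]; ring
  · refine (integrable_const (1 : ℝ)).mono' (by fun_prop) (Filter.Eventually.of_forall fun p => ?_)
    rw [Complex.norm_exp_ofReal_mul_I]

theorem integral_exp_neg_mul_map_stableScale [IsProbabilityMeasure P] {W Θ : Ω → ℝ} {α : ℝ}
    (hα₀ : 0 < α) (hα₂ : α ≤ 2) (hW : HasLaw W (expMeasure 1) P)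
    (hΘ : pdf.IsUniform Θ (Set.Icc (-(Real.pi / 2)) (Real.pi / 2)) P)
    (hind : IndepFun W Θ P) {s : ℝ} (hs : 0 ≤ s) :
    ∫ x, Real.exp (-(s * x)) ∂P.map (fun ω => stableScale α (W ω) (Θ ω)) =
      Real.exp (-s ^ (α / 2)) := by
  have h := (mgf_neg_of_laplace
    (fun s hs => lintegral_exp_neg_mul_map_stableScale hα₀ hα₂ hW hΘ hind hs) hs).2
  simpa [mgf] using h

theorem isSymmetricStable_mixture [IsProbabilityMeasure P] {d : ℕ} {α : ℝ}
    (hα₀ : 0 < α) (hα₂ : α ≤ 2) {W Θ : Ω → ℝ} {N : Ω → EuclideanSpace ℝ (Fin d)}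
    (hW : HasLaw W (expMeasure 1) P)
    (hΘ : pdf.IsUniform Θ (Set.Icc (-(Real.pi / 2)) (Real.pi / 2)) P)
    (hN : HasLaw N (stdGaussian (EuclideanSpace ℝ (Fin d))) P)
    (hWΘ : IndepFun W Θ P) (hWΘN : IndepFun (fun ω => (W ω, Θ ω)) N P) :
    IsSymmetricStable α
      (fun ω => Real.sqrt (2 * stableScale α (W ω) (Θ ω)) • N ω) P := by
  have hA := aemeasurable_stableScale α hW.aemeasurable (aemeasurable_of_isUniform hΘ)
  have hNm := hN.aemeasurable
  have hind : IndepFun (fun ω => stableScale α (W ω) (Θ ω)) N P :=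
    hWΘN.comp (ψ := id) (measurable_stableScale α) measurable_id
  have hmeas : AEMeasurable (fun ω => Real.sqrt (2 * stableScale α (W ω) (Θ ω))) P :=
    (hA.const_mul 2).sqrt
  refine ⟨hmeas.smul hNm, fun u => ?_⟩
  rw [charFun_gaussian_scale_mixture hA (ae_stableScale_pos hα₀ hα₂ hW hΘ) hN hind,
    integral_exp_neg_mul_map_stableScale hα₀ hα₂ hW hΘ hWΘ (by positivity),
    ← Real.rpow_natCast, ← Real.rpow_mul (norm_nonneg u)]
  congr 4
  push_cast; ring

theorem IsSymmetricStable.identDistrib {Ω' : Type*} [MeasurableSpace Ω'] {P' : Measure Ω'}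
    [IsFiniteMeasure P] [IsFiniteMeasure P'] {d : ℕ} {α : ℝ}
    {S : Ω → EuclideanSpace ℝ (Fin d)} {T : Ω' → EuclideanSpace ℝ (Fin d)}
    (hS : IsSymmetricStable α S P) (hT : IsSymmetricStable α T P') : IdentDistrib S T P P' :=
  ⟨hS.1, hT.1, Measure.ext_of_charFun (funext fun u => by rw [hS.2, hT.2])⟩

theorem hasStableLaw_stableScale [IsProbabilityMeasure P] {α : ℝ}
    (hα₀ : 0 < α) (hα₂ : α < 2) {W Θ : Ω → ℝ} (hW : HasLaw W (expMeasure 1) P)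
    (hΘ : pdf.IsUniform Θ (Set.Icc (-(Real.pi / 2)) (Real.pi / 2)) P)
    (hWΘ : IndepFun W Θ P) :
    HasStableLaw (α / 2) (Real.cos (Real.pi * α / 4) ^ (2 / α)) 1 0
      (fun ω => stableScale α (W ω) (Θ ω)) P := by
  have hA := aemeasurable_stableScale α hW.aemeasurable (aemeasurable_of_isUniform hΘ)
  have := Measure.isProbabilityMeasure_map hA
  have hcos : 0 < Real.cos (Real.pi * α / 4) :=
    Real.cos_pos_of_mem_Ioo ⟨by nlinarith [Real.pi_pos], by nlinarith [Real.pi_pos]⟩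
  refine ⟨by linarith, by linarith, Real.rpow_pos_of_pos hcos _, by norm_num, hA, fun t => ?_⟩
  rw [charFun_eq_of_laplace (by linarith)
    ((ae_map_iff hA measurableSet_Ioi).2 (ae_stableScale_pos hα₀ hα₂.le hW hΘ))
    (fun s hs => lintegral_exp_neg_mul_map_stableScale hα₀ hα₂.le hW hΘ hWΘ hs),
    neg_cpow_eq_stableExponent (by linarith) (by linarith),
    show Real.pi * (α / 2) / 2 = Real.pi * α / 4 by ring, one_div_div]
end

theorem proposition1 {Ω Ω' : Type*} [MeasurableSpace Ω] [MeasurableSpace Ω']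
    (P : Measure Ω) [IsProbabilityMeasure P] (P' : Measure Ω') [IsProbabilityMeasure P']
    (d : ℕ) (α : ℝ) (hα₀ : 0 < α) (hα₂ : α ≤ 2) :
    -- the two auxiliary variables may be taken to be `-log U₁` and `π (U₂ - 1/2)`
    (∀ U : Ω → ℝ, pdf.IsUniform U (Set.Icc 0 1) P →
      HasLaw (fun ω => -Real.log (U ω)) (expMeasure 1) P ∧
      pdf.IsUniform (fun ω => Real.pi * (U ω - 1 / 2))
        (Set.Icc (-(Real.pi / 2)) (Real.pi / 2)) P) ∧
    ∀ (W Θ : Ω → ℝ) (N : Ω → EuclideanSpace ℝ (Fin d)),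
      HasLaw W (expMeasure 1) P →
      pdf.IsUniform Θ (Set.Icc (-(Real.pi / 2)) (Real.pi / 2)) P →
      HasLaw N (stdGaussian (EuclideanSpace ℝ (Fin d))) P →
      -- mutual independence of `W`, `Θ`, `N`
      IndepFun W Θ P → IndepFun (fun ω => (W ω, Θ ω)) N P →
      -- the Gaussian scale mixture is symmetric `α`-stable
      IsSymmetricStable α
        (fun ω => Real.sqrt (2 * stableScale α (W ω) (Θ ω)) • N ω) P ∧
      -- every symmetric `α`-stable vector has the distribution of the mixture
      (∀ S : Ω' → EuclideanSpace ℝ (Fin d), IsSymmetricStable α S P' →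
        IdentDistrib S
          (fun ω => Real.sqrt (2 * stableScale α (W ω) (Θ ω)) • N ω) P' P) ∧
      -- the scaling variable is positive and totally skewed `α/2`-stable
      (∀ᵐ ω ∂P, 0 < stableScale α (W ω) (Θ ω)) ∧
      (α < 2 → HasStableLaw (α / 2) (Real.cos (Real.pi * α / 4) ^ (2 / α)) 1 0
        (fun ω => stableScale α (W ω) (Θ ω)) P) ∧
      (α = 2 → ∀ᵐ ω ∂P, stableScale α (W ω) (Θ ω) = 1) := by
  refine ⟨fun U hU => ⟨hasLaw_neg_log_of_isUniform hU, isUniform_pi_mul_sub_half hU⟩,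
    fun W Θ N hW hΘ hN hWΘ hWΘN => ?_⟩
  have hmix := isSymmetricStable_mixture hα₀ hα₂ hW hΘ hN hWΘ hWΘN
  refine ⟨hmix, fun S hS => hS.identDistrib hmix, ae_stableScale_pos hα₀ hα₂ hW hΘ,
    fun h => hasStableLaw_stableScale hα₀ h hW hΘ hWΘ, ?_⟩
  rintro rfl
  exact ae_stableScale_two_eq_one hΘ
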